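/- Let $J,M,s,L$ be natural numbers with $1\le s<M$. For $j=1,\dots,J$ let $D_j\in\mathbb R^{N_j\times M}$ (a dictionary, whose columns are called atoms), $X_j=[x_j^1,\dots,x_j^L]\in\mathbb R^{M\times L}$ and $Y_j=D_jX_j=[y_j^1,\dots,y_j^L]$. Let $\operatorname{spark}(D_j)$ be the minimum number of linearly dependent columns of $D_j$ ($\infty$ if the columns are linearly independent), and say that $y_j^i$ is generated by the atoms of $D_j$ whose indices form the support of $x_j^i$. Consider the following assumptions on the modality $j$: 1. every $x_j^i$ has exactly $s$ nonzero entries, and $s<\operatorname{spark}(D_j)/2$; 2. for every set of $s$ atoms of $D_j$, $Y_j$ contains at least $s+1$ different points generated by exactly these atoms; 3. every group of $s+1$ different points of $Y_j$ that are all generated by the same $s$ atoms has rank exactly $s$, and every group of $s+1$ different points of $Y_j$ that are not all generated by the same $s$ atoms has rank exactly $s+1$. (i) If Assumptions 1–3 hold for every $j$, then for every $j$ the factorization $Y_j=D_jX_j$ is unique up to permutation and scaling: whenever $Y_j=D'X'$ with $D'\in\mathbb R^{N_j\times M}$ and $X'\in\mathbb R^{M\times L}$ each of whose columns has at most $s$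 nonzero entries, there is a matrix $Z$, the product of a permutation matrix and an invertible diagonal matrix, such that $D'=D_jZ$ and $X_j=ZX'$. (ii) The minimum total number of samples (the number $JL$ of data points over all modalities) for which this guarantee applies is $J(s+1)\binom Ms$: Assumptions 1–3 for all $j$ force $JL\ge J(s+1)\binom Ms$; and whenever $s<\operatorname{spark}(D_j)/2$ for all $j$, the number $J(s+1)\binom Ms$ is the least value of $JL$ over all $L$ and all $X_1,\dots,X_J\in\mathbb R^{M\times L}$ such that Assumptions 1–3 hold for all $j$ and, for each $i$, the vectors $x_1^i,\dots,x_J^i$ have the same support. -/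

import Mathlib

namespace DictLearning

/-- The spark of a matrix: the least number of linearly dependent columns
(`⊤` if the columns are linearly independent). -/
noncomputable def spark {N M : ℕ} (D : Matrix (Fin N) (Fin M) ℝ) : ℕ∞ :=
  sInf {n : ℕ∞ | ∃ S : Finset (Fin M),
    (S.card : ℕ∞) = n ∧ ¬ LinearIndependent ℝ (fun m : S => D.col (m : Fin M))}

/-- Every code has exactly `s` nonzero entries, and `s < spark D / 2`. -/
def SparsityAssumption {N M L : ℕ} (s : ℕ) (D : Matrix (Fin N) (Fin M) ℝ)
    (X : Matrix (Fin M) (Fin L) ℝ) : Prop :=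
  (∀ i, hammingNorm (X.col i) = s) ∧ 2 * (s : ℕ∞) < spark D

/-- For every set `S` of `s` atoms, the data contain at least `s + 1` different points that are
generated by exactly the atoms in `S`. -/
def RichnessAssumption {N M L : ℕ} (s : ℕ) (Y : Matrix (Fin N) (Fin L) ℝ)
    (X : Matrix (Fin M) (Fin L) ℝ) : Prop :=
  ∀ S : Finset (Fin M), S.card = s →
    s + 1 ≤ (Y.col '' {i | Function.support (X.col i) = (S : Set (Fin M))}).ncard

/-- The data points with indices in `I` are all generated by the same atoms. -/
def SameAtoms {M L : ℕ} (X : Matrix (Fin M) (Fin L) ℝ) (I : Finset (Fin L)) : Prop :=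
  ∀ i ∈ I, ∀ k ∈ I, Function.support (X.col i) = Function.support (X.col k)

/-- Every group of `s + 1` different data points has rank exactly `s` if all of them are generated
by the same atoms, and rank exactly `s + 1` otherwise. -/
def NondegeneracyAssumption {N M L : ℕ} (s : ℕ) (Y : Matrix (Fin N) (Fin L) ℝ)
    (X : Matrix (Fin M) (Fin L) ℝ) : Prop :=
  ∀ I : Finset (Fin L), I.card = s + 1 → Set.InjOn Y.col (I : Set (Fin L)) →
    (SameAtoms X I → Set.finrank ℝ (Y.col '' (I : Set (Fin L))) = s) ∧
    (¬ SameAtoms X I → Set.finrank ℝ (Y.col '' (I : Set (Fin L))) = s + 1)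

/-- The three assumptions on one modality, with data `Y = D * X`. -/
def Assumptions {N M L : ℕ} (s : ℕ) (D : Matrix (Fin N) (Fin M) ℝ)
    (X : Matrix (Fin M) (Fin L) ℝ) : Prop :=
  SparsityAssumption s D X ∧ RichnessAssumption s (D * X) X ∧
    NondegeneracyAssumption s (D * X) X

/-- `Y = D * X`, where every column of `X` has at most `s` nonzero entries. -/
def IsSparseFactorization {N M L : ℕ} (s : ℕ) (Y : Matrix (Fin N) (Fin L) ℝ)
    (D : Matrix (Fin N) (Fin M) ℝ) (X : Matrix (Fin M) (Fin L) ℝ) : Prop :=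
  Y = D * X ∧ ∀ i, hammingNorm (X.col i) ≤ s

/-- A permutation and scaling matrix. -/
def IsPermScaling {M : ℕ} (Z : Matrix (Fin M) (Fin M) ℝ) : Prop :=
  ∃ (σ : Equiv.Perm (Fin M)) (c : Fin M → ℝ),
    (∀ m, c m ≠ 0) ∧ Z = σ.permMatrix ℝ * Matrix.diagonal c

/-- `D * X` is an `s`-sparse factorization of `Y`, and every other one with the same number of
atoms arises from it by permuting and scaling the atoms. -/
def IsUniqueFactorization {N M L : ℕ} (s : ℕ) (Y : Matrix (Fin N) (Fin L) ℝ)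
    (D : Matrix (Fin N) (Fin M) ℝ) (X : Matrix (Fin M) (Fin L) ℝ) : Prop :=
  IsSparseFactorization s Y D X ∧
    ∀ (D' : Matrix (Fin N) (Fin M) ℝ) (X' : Matrix (Fin M) (Fin L) ℝ),
      IsSparseFactorization s Y D' X' →
        ∃ Z : Matrix (Fin M) (Fin M) ℝ, IsPermScaling Z ∧ D' = D * Z ∧ X = Z * X'

/-- For each instance `i`, the codes of all modalities have the same support. -/
def CommonSparsityProfile {J M L : ℕ} (X : Fin J → Matrix (Fin M) (Fin L) ℝ) : Prop :=
  ∀ i j j', Function.support ((X j).col i) = Function.support ((X j').col i)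

end DictLearning

namespace DictLearning

open Module

variable {N M L s : ℕ}

/-! Uniqueness is a pigeonhole argument. Pick `s + 1` distinct points for each `s`-set of atoms of
`D`, and assign each picked point to an `s`-set `p` of atoms of `D'` whose span contains it. By
nondegeneracy, `s + 1` points with differing supports do not fit in a span of `s` atoms, so a fibre
with at least `s + 1` points lies in one group. There are as many fibres as groups, hence every
fibre is exactly a group, and comparing ranks shows that `p` and the matching set `φ p` span the
same space (`Assumptions.exists_injective_span_eq`).

An atom `m` of `D'` lies in the span of `φ p` for all `p` containing `m`. The spark bound makes
sparse codes unique (`eq_of_mulVec_eq`), so one code serves all these `p`; counting and `s < M`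
shrink its support to one index (`exists_perm_scaling_col`). Uniqueness of codes then settles `X`.

The lower bound counts disjoint groups. It is attained by choosing points one at a time, off
finitely many proper subspaces (`exists_codes_general_position`). -/

/-! ### Sparse codes and spans of atoms -/

theorem mulVec_eq_sum_smul_col (D : Matrix (Fin N) (Fin M) ℝ) (v : Fin M → ℝ) :
    D.mulVec v = ∑ m, v m • D.col m := by
  ext i
  simp [Matrix.mulVec, dotProduct, Finset.sum_apply, mul_comm]

theorem mul_col (D : Matrix (Fin N) (Fin M) ℝ) (X : Matrix (Fin M) (Fin L) ℝ) (i : Fin L) :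
    (D * X).col i = D.mulVec (X.col i) := rfl

theorem mulVec_eq_sum_of_support_subset (D : Matrix (Fin N) (Fin M) ℝ) {v : Fin M → ℝ}
    {S : Finset (Fin M)} (h : Function.support v ⊆ S) :
    D.mulVec v = ∑ m ∈ S, v m • D.col m := by
  rw [mulVec_eq_sum_smul_col]
  refine (Finset.sum_subset (Finset.subset_univ S) fun m _ hm => ?_).symm
  have : v m = 0 := by
    by_contra h0
    exact hm (by exact_mod_cast h h0)
  simp [this]

/-- The span of the atoms with indices in `S`. -/
def atomSpan (D : Matrix (Fin N) (Fin M) ℝ) (S : Finset (Fin M)) :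
    Submodule ℝ (Fin N → ℝ) :=
  Submodule.span ℝ (D.col '' S)

theorem mulVec_mem_atomSpan (D : Matrix (Fin N) (Fin M) ℝ) {v : Fin M → ℝ}
    {S : Finset (Fin M)} (h : Function.support v ⊆ S) : D.mulVec v ∈ atomSpan D S := by
  rw [mulVec_eq_sum_of_support_subset D h]
  exact Submodule.sum_mem _ fun m hm =>
    Submodule.smul_mem _ _ (Submodule.subset_span ⟨m, hm, rfl⟩)

theorem exists_mulVec_eq_of_mem_atomSpan {D : Matrix (Fin N) (Fin M) ℝ}
    {S : Finset (Fin M)} {y : Fin N → ℝ} (h : y ∈ atomSpan D S) :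
    ∃ v : Fin M → ℝ, Function.support v ⊆ S ∧ D.mulVec v = y := by
  classical
  obtain ⟨c, hc⟩ := (Submodule.mem_span_image_finset_iff_exists_fun ℝ).1 h
  have hv : Function.support (fun m => if hm : m ∈ S then c ⟨m, hm⟩ else 0) ⊆ S := by
    intro m hm
    by_contra h0
    exact hm (dif_neg h0)
  refine ⟨_, hv, ?_⟩
  rw [mulVec_eq_sum_of_support_subset D hv, ← hc, ← Finset.sum_coe_sort S]
  refine Finset.sum_congr rfl fun m _ => ?_
  simp

theorem finrank_atomSpan_le (D : Matrix (Fin N) (Fin M) ℝ) (S : Finset (Fin M)) :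
    finrank ℝ (atomSpan D S) ≤ S.card := by
  classical
  have h := finrank_span_finset_le_card (R := ℝ) (S.image D.col)
  rw [Set.finrank, Finset.coe_image] at h
  exact h.trans Finset.card_image_le

theorem linearIndepOn_col_of_lt_spark {D : Matrix (Fin N) (Fin M) ℝ} {S : Finset (Fin M)}
    (h : (S.card : ℕ∞) < spark D) : LinearIndepOn ℝ D.col (S : Set (Fin M)) := by
  by_contra h0
  exact not_le.2 h (sInf_le ⟨S, rfl, h0⟩)

theorem finrank_span_image_of_linearIndepOn {ι V : Type*} [AddCommGroup V] [Module ℝ V]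
    {f : ι → V} {I : Finset ι} (h : LinearIndepOn ℝ f (I : Set ι)) :
    finrank ℝ (Submodule.span ℝ (f '' I)) = I.card := by
  have := finrank_span_eq_card (R := ℝ) h.linearIndependent
  rw [Set.image_eq_range]
  simpa using this

theorem finrank_atomSpan {D : Matrix (Fin N) (Fin M) ℝ} (hD : 2 * (s : ℕ∞) < spark D)
    {S : Finset (Fin M)} (hS : S.card = s) : finrank ℝ (atomSpan D S) = s := by
  have h : (S.card : ℕ∞) < spark D := by
    refine lt_of_le_of_lt ?_ hD
    rw [hS]
    exact_mod_cast (by omega : s ≤ 2 * s)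
  rw [atomSpan, finrank_span_image_of_linearIndepOn (linearIndepOn_col_of_lt_spark h), hS]

/-- A vector has at most one code supported on at most half the spark. -/
theorem eq_of_mulVec_eq {D : Matrix (Fin N) (Fin M) ℝ} (hD : 2 * (s : ℕ∞) < spark D)
    {v w : Fin M → ℝ} {S T : Finset (Fin M)} (hS : S.card ≤ s) (hT : T.card ≤ s)
    (hv : Function.support v ⊆ S) (hw : Function.support w ⊆ T)
    (h : D.mulVec v = D.mulVec w) : v = w := by
  classical
  have hcard : ((S ∪ T).card : ℕ∞) < spark D := by
    refine lt_of_le_of_lt ?_ hD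
    have := Finset.card_union_le S T
    exact_mod_cast (by omega : (S ∪ T).card ≤ 2 * s)
  have hsupp : Function.support (v - w) ⊆ (S ∪ T : Finset (Fin M)) := by
    refine (Function.support_sub v w).trans ?_
    rw [Finset.coe_union]
    exact Set.union_subset_union hv hw
  have h0 : D.mulVec (v - w) = 0 := by rw [Matrix.mulVec_sub, h, sub_self]
  rw [mulVec_eq_sum_of_support_subset D hsupp] at h0
  have h1 := linearIndepOn_finset_iff.1 (linearIndepOn_col_of_lt_spark hcard) _ h0
  ext m
  by_contra hm
  have hm' : (v - w) m ≠ 0 := by simpa [sub_eq_zero] using hm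
  exact hm' (h1 m (by exact_mod_cast hsupp hm'))

/-- Padding the support lets every code with at most `s` nonzero entries be indexed by a set of size
exactly `s`. -/
theorem exists_support_subset_card_eq {v : Fin M → ℝ} (hv : hammingNorm v ≤ s) (hsM : s ≤ M) :
    ∃ S : Finset (Fin M), S.card = s ∧ Function.support v ⊆ S := by
  classical
  obtain ⟨S, hS, hc⟩ := Finset.exists_superset_card_eq (s := Finset.univ.filter (v · ≠ 0))
    (n := s) hv (by simpa using hsM)
  exact ⟨S, hc, fun m hm => hS (by simpa using hm)⟩

theorem hammingNorm_eq_card_of_support_eq {v : Fin M → ℝ} {S : Finset (Fin M)}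
    (h : Function.support v = S) : hammingNorm v = S.card := by
  classical
  rw [hammingNorm]
  congr 1
  ext m
  have := Set.ext_iff.1 h m
  simpa using this

theorem exists_support_eq_card_eq {v : Fin M → ℝ} (hv : hammingNorm v = s) :
    ∃ S : Finset (Fin M), S.card = s ∧ Function.support v = S := by
  classical
  have h : Function.support v = (Finset.univ.filter (v · ≠ 0) : Finset (Fin M)) := by
    ext m; simp
  exact ⟨_, hv ▸ (hammingNorm_eq_card_of_support_eq h).symm, h⟩

/-! ### Groups of points and the lower bound -/

/-- The `s`-element subsets of `Fin M`. -/
abbrev Subsets (M s : ℕ) : Type := {S : Finset (Fin M) // S.card = s}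

/-- From the richness assumption one picks `s + 1` different points for each set of atoms. -/
theorem RichnessAssumption.exists_points {Y : Matrix (Fin N) (Fin L) ℝ}
    {X : Matrix (Fin M) (Fin L) ℝ} (h : RichnessAssumption s Y X) :
    ∃ T : Subsets M s → Finset (Fin L), ∀ S, (T S).card = s + 1 ∧
      Set.InjOn Y.col (T S : Set (Fin L)) ∧
      ∀ i ∈ T S, Function.support (X.col i) = (S.1 : Set (Fin M)) := by
  classical
  have key : ∀ S : Subsets M s, ∃ T : Finset (Fin L), T.card = s + 1 ∧
      Set.InjOn Y.col (T : Set (Fin L)) ∧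
      ∀ i ∈ T, Function.support (X.col i) = (S.1 : Set (Fin M)) := by
    intro S
    -- `A` keeps one index per distinct point, so counting points becomes counting indices.
    obtain ⟨A, hA, hb⟩ := Set.exists_subset_bijOn
      {i | Function.support (X.col i) = (S.1 : Set (Fin M))} Y.col
    have h1 := h S.1 S.2
    rw [← hb.image_eq, hb.injOn.ncard_image,
      Set.ncard_eq_toFinset_card' A] at h1
    obtain ⟨T, hT, hc⟩ := Finset.exists_subset_card_eq h1
    have hTA : (T : Set (Fin L)) ⊆ A := fun i hi => by simpa using hT hi
    exact ⟨T, hc, hb.injOn.mono hTA, fun i hi => hA (hTA hi)⟩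
  choose T hT using key
  exact ⟨T, hT⟩

theorem card_biUnion_points {X : Matrix (Fin M) (Fin L) ℝ} {T : Subsets M s → Finset (Fin L)}
    (hcard : ∀ S, (T S).card = s + 1)
    (hT : ∀ S, ∀ i ∈ T S, Function.support (X.col i) = (S.1 : Set (Fin M))) :
    (Finset.univ.biUnion T).card = (s + 1) * Fintype.card (Subsets M s) := by
  classical
  rw [Finset.card_biUnion]
  · simp [hcard, mul_comm]
  · intro S _ S' _ hne
    refine Finset.disjoint_left.2 fun i hi hi' => hne ?_
    have := (hT S i hi).symm.trans (hT S' i hi')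
    exact Subtype.ext (by exact_mod_cast this)

theorem RichnessAssumption.le_card {Y : Matrix (Fin N) (Fin L) ℝ}
    {X : Matrix (Fin M) (Fin L) ℝ} (h : RichnessAssumption s Y X) :
    (s + 1) * M.choose s ≤ L := by
  classical
  obtain ⟨T, hT⟩ := h.exists_points
  have h1 := card_biUnion_points (fun S => (hT S).1) (fun S => (hT S).2.2)
  have h2 := Finset.card_le_univ (Finset.univ.biUnion T)
  rw [h1, Fintype.card_finset_len] at h2
  simpa using h2

/-- Two `s`-sparse codes whose data points coincide are equal. -/
theorem SparsityAssumption.injective_code {D : Matrix (Fin N) (Fin M) ℝ}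
    {X : Matrix (Fin M) (Fin L) ℝ} (h : SparsityAssumption s D X) {i k : Fin L}
    (hik : (D * X).col i = (D * X).col k) : X.col i = X.col k := by
  obtain ⟨S, hS, hS'⟩ := exists_support_eq_card_eq (h.1 i)
  obtain ⟨T, hT, hT'⟩ := exists_support_eq_card_eq (h.1 k)
  exact eq_of_mulVec_eq h.2 hS.le hT.le hS'.subset hT'.subset hik

theorem finrank_atomSpan_lt_of_col_eq_zero {D : Matrix (Fin N) (Fin M) ℝ} {S : Finset (Fin M)}
    {m : Fin M} (hm : m ∈ S) (h0 : D.col m = 0) : finrank ℝ (atomSpan D S) < S.card := by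
  classical
  have : atomSpan D S = atomSpan D (S.erase m) := by
    rw [atomSpan, atomSpan]
    conv_lhs => rw [← Finset.insert_erase hm]
    rw [Finset.coe_insert, Set.image_insert_eq, h0, Submodule.span_insert_zero]
  rw [this]
  exact (finrank_atomSpan_le D _).trans_lt (Finset.card_erase_lt_of_mem hm)

/-! ### Matching the spans of two factorizations -/

/-- The sets of atoms in a second sparse factorization correspond injectively to those of the
first one, in such a way that corresponding sets of atoms have the same span. -/
theorem Assumptions.exists_injective_span_eq {D D' : Matrix (Fin N) (Fin M) ℝ}
    {X X' : Matrix (Fin M) (Fin L) ℝ} (hs : 0 < s) (hsM : s ≤ M) (h : Assumptions s D X)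
    (h' : IsSparseFactorization s (D * X) D' X') :
    ∃ φ : Subsets M s → Subsets M s, Function.Injective φ ∧
      ∀ p, atomSpan D' p.1 = atomSpan D (φ p).1 := by
  classical
  obtain ⟨h1, h2, h3⟩ := h
  obtain ⟨T, hT⟩ := h2.exists_points
  choose hTc hTi hTs using hT
  set U := Finset.univ.biUnion T with hU
  have hUi : Set.InjOn (D * X).col (U : Set (Fin L)) := by
    intro i hi k hk hik
    simp only [hU, Finset.coe_biUnion, Set.mem_iUnion] at hi hk
    obtain ⟨S, -, hi⟩ := hi
    obtain ⟨S', -, hk⟩ := hk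
    have hSS : S = S' := by
      refine Subtype.ext ?_
      have := (hTs S i hi).symm.trans ((congrArg Function.support (h1.injective_code hik)).trans
        (hTs S' k hk))
      exact_mod_cast this
    subst hSS
    exact hTi S hi hk hik
  have hg : ∀ i, ∃ p : Subsets M s, Function.support (X'.col i) ⊆ (p.1 : Set (Fin M)) := by
    intro i
    obtain ⟨S, hS, hS'⟩ := exists_support_subset_card_eq (h'.2 i) hsM
    exact ⟨⟨S, hS⟩, hS'⟩
  choose g hg using hg
  have hYg : ∀ i, (D * X).col i ∈ atomSpan D' (g i).1 := by
    intro i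
    rw [h'.1, mul_col]
    exact mulVec_mem_atomSpan D' (hg i)
  set F : Subsets M s → Finset (Fin L) := fun p => U.filter (g · = p) with hF
  have hsame : ∀ p, ∀ I ⊆ F p, I.card = s + 1 → SameAtoms X I := by
    intro p I hI hc
    by_contra hn
    have hIU : (I : Set (Fin L)) ⊆ U := fun i hi => (Finset.mem_filter.1 (hI hi)).1
    have hr := (h3 I hc (hUi.mono hIU)).2 hn
    have hle : Submodule.span ℝ ((D * X).col '' (I : Set (Fin L))) ≤ atomSpan D' p.1 := by
      rw [Submodule.span_le]
      rintro _ ⟨i, hi, rfl⟩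
      rw [← (Finset.mem_filter.1 (hI hi)).2]
      exact hYg i
    have := (Submodule.finrank_mono hle).trans (finrank_atomSpan_le D' p.1)
    rw [Set.finrank] at hr
    rw [hr, p.2] at this
    omega
  -- Any two points of a large fibre lie in a common subset of size `s + 1`, as `2 ≤ s + 1`; hence
  -- they have the same support.
  have hsub : ∀ p, s + 1 ≤ (F p).card → ∃ S, F p ⊆ T S := by
    intro p hp
    obtain ⟨i₀, hi₀⟩ := Finset.card_pos.1 (lt_of_lt_of_le (Nat.succ_pos s) hp)
    obtain ⟨S, -, hS⟩ := Finset.mem_biUnion.1 (Finset.mem_filter.1 hi₀).1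
    refine ⟨S, fun k hk => ?_⟩
    obtain ⟨S', -, hS'⟩ := Finset.mem_biUnion.1 (Finset.mem_filter.1 hk).1
    have hpair : ({i₀, k} : Finset (Fin L)) ⊆ F p := by
      simp [Finset.insert_subset_iff, hi₀, hk]
    obtain ⟨I, hI, hIF, hIc⟩ := Finset.exists_subsuperset_card_eq hpair
      (Finset.card_le_two.trans (by omega : 2 ≤ s + 1)) hp
    have := hsame p I hIF hIc i₀ (hI (by simp)) k (hI (by simp))
    rw [hTs S i₀ hS, hTs S' k hS'] at this
    have hSS : S = S' := Subtype.ext (by exact_mod_cast this)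
    exact hSS ▸ hS'
  have hle : ∀ p ∈ (Finset.univ : Finset (Subsets M s)), (F p).card ≤ s + 1 := by
    intro p _
    by_contra! hlt
    obtain ⟨S, hS⟩ := hsub p hlt.le
    have := Finset.card_le_card hS
    rw [hTc] at this
    omega
  -- The fibres partition `U`, whose size equals the sum of the upper bounds, so every bound is
  -- attained.
  have hsum : ∑ p, (F p).card = ∑ _p : Subsets M s, (s + 1) := by
    rw [← Finset.card_eq_sum_card_fiberwise (f := g) (s := U) (t := Finset.univ)
      (fun _ _ => by simp), hU, card_biUnion_points hTc hTs]
    simp [mul_comm]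
  have heq := (Finset.sum_eq_sum_iff_of_le hle).1 hsum
  have hφ : ∀ p, ∃ S, F p = T S := by
    intro p
    obtain ⟨S, hS⟩ := hsub p (heq p (Finset.mem_univ p)).ge
    exact ⟨S, Finset.eq_of_subset_of_card_le hS (by rw [hTc, heq p (Finset.mem_univ p)])⟩
  choose φ hφ using hφ
  refine ⟨φ, fun p q hpq => ?_, fun p => ?_⟩
  · have hFF : F p = F q := by rw [hφ, hφ, hpq]
    obtain ⟨i, hi⟩ := Finset.card_pos.1
      (lt_of_lt_of_eq (Nat.succ_pos s) (heq p (Finset.mem_univ p)).symm)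
    have hi' := hi
    rw [hFF] at hi'
    rw [← (Finset.mem_filter.1 hi).2, (Finset.mem_filter.1 hi').2]
  · have hr : finrank ℝ (Submodule.span ℝ ((D * X).col '' (F p : Set (Fin L)))) = s := by
      rw [hφ]
      refine (h3 (T (φ p)) (hTc _) (hTi _)).1 fun i hi k hk => ?_
      rw [hTs _ i hi, hTs _ k hk]
    have e1 : Submodule.span ℝ ((D * X).col '' (F p : Set (Fin L))) = atomSpan D' p.1 := by
      refine Submodule.eq_of_le_of_finrank_le ?_ ?_
      · rw [Submodule.span_le]
        rintro _ ⟨i, hi, rfl⟩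
        rw [← (Finset.mem_filter.1 hi).2]
        exact hYg i
      · rw [hr]
        exact (finrank_atomSpan_le D' p.1).trans p.2.le
    have e2 : Submodule.span ℝ ((D * X).col '' (F p : Set (Fin L))) = atomSpan D (φ p).1 := by
      refine Submodule.eq_of_le_of_finrank_le ?_ ?_
      · rw [Submodule.span_le]
        rintro _ ⟨i, hi, rfl⟩
        rw [hφ] at hi
        exact mulVec_mem_atomSpan D (hTs _ i hi).subset
      · rw [hr]
        exact (finrank_atomSpan_le D _).trans (φ p).2.le
    rw [← e1, e2]

/-! ### Recovering the atoms -/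

theorem exists_subset_mem (hs : 0 < s) (hsM : s ≤ M) (m : Fin M) :
    ∃ p : Subsets M s, m ∈ p.1 := by
  obtain ⟨S, hS, hc⟩ := Finset.exists_superset_card_eq (s := {m}) (n := s) (by simpa using Nat.one_le_iff_ne_zero.2 hs.ne')
    (by simpa using hsM)
  exact ⟨⟨S, hc⟩, hS (by simp)⟩

theorem exists_subset_mem_notMem (hs : 0 < s) (hsM : s < M) {m n : Fin M} (hmn : m ≠ n) :
    ∃ p : Subsets M s, m ∈ p.1 ∧ n ∉ p.1 := by
  classical
  obtain ⟨S, hS, hS', hc⟩ := Finset.exists_subsuperset_card_eq (s := {m})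
    (t := Finset.univ.erase n) (n := s) (by simpa using hmn) (by simpa using Nat.one_le_iff_ne_zero.2 hs.ne')
    (by rw [Finset.card_erase_of_mem (Finset.mem_univ n)]; simp; omega)
  exact ⟨⟨S, hc⟩, hS (by simp), fun h => by simpa using hS' h⟩

/-- Transposing `m` and `n` is a bijection between the two families. -/
theorem card_subsets_mem (m n : Fin M) :
    (Finset.univ.filter fun p : Subsets M s => m ∈ p.1).card =
      (Finset.univ.filter fun p : Subsets M s => n ∈ p.1).card := by
  classical
  have key : ∀ S : Finset (Fin M), (S.map (Equiv.swap m n).toEmbedding).map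
      (Equiv.swap m n).toEmbedding = S := by
    intro S
    ext k
    simp
  refine Finset.card_bij' (fun p _ => ⟨p.1.map (Equiv.swap m n).toEmbedding, by simp [p.2]⟩)
    (fun p _ => ⟨p.1.map (Equiv.swap m n).toEmbedding, by simp [p.2]⟩) ?_ ?_ ?_ ?_
  · intro p hp
    simpa using hp
  · intro p hp
    simpa using hp
  · intro p _
    exact Subtype.ext (key p.1)
  · intro p _
    exact Subtype.ext (key p.1)

/-- An injective correspondence between sets of atoms with equal spans comes from a permutation
and scaling of the atoms. -/
theorem exists_perm_scaling_col {D D' : Matrix (Fin N) (Fin M) ℝ} (hs : 0 < s) (hsM : s < M)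
    (hD : 2 * (s : ℕ∞) < spark D) {φ : Subsets M s → Subsets M s} (hφ : Function.Injective φ)
    (hspan : ∀ p, atomSpan D' p.1 = atomSpan D (φ p).1) :
    ∃ (σ : Equiv.Perm (Fin M)) (c : Fin M → ℝ), (∀ m, c m ≠ 0) ∧
      ∀ m, D'.col m = c m • D.col (σ m) := by
  classical
  have hmem : ∀ (p : Subsets M s) (m : Fin M), m ∈ p.1 → D'.col m ∈ atomSpan D (φ p).1 := by
    intro p m hm
    rw [← hspan]
    exact Submodule.subset_span ⟨m, hm, rfl⟩
  have hcode : ∀ m, ∃ v : Fin M → ℝ, D.mulVec v = D'.col m ∧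
      ∀ p : Subsets M s, m ∈ p.1 → Function.support v ⊆ ((φ p).1 : Set (Fin M)) := by
    intro m
    obtain ⟨p, hp⟩ := exists_subset_mem hs hsM.le m
    obtain ⟨v, hv, hv'⟩ := exists_mulVec_eq_of_mem_atomSpan (hmem p m hp)
    refine ⟨v, hv', fun q hq => ?_⟩
    obtain ⟨w, hw, hw'⟩ := exists_mulVec_eq_of_mem_atomSpan (hmem q m hq)
    rwa [eq_of_mulVec_eq hD (φ p).2.le (φ q).2.le hv hw (hv'.trans hw'.symm)]
  choose v hv hvs using hcode
  have hne : ∀ m, ∃ k, v m k ≠ 0 := by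
    intro m
    by_contra! h0
    have hv0 : v m = 0 := funext h0
    have hcol : D'.col m = 0 := by rw [← hv m, hv0, Matrix.mulVec_zero]
    obtain ⟨p, hp⟩ := exists_subset_mem hs hsM.le m
    have := finrank_atomSpan_lt_of_col_eq_zero hp hcol
    rw [hspan, finrank_atomSpan hD (φ p).2, p.2] at this
    exact lt_irrefl _ this
  choose π hπ using hne
  have hfwd : ∀ (m : Fin M) (p : Subsets M s), m ∈ p.1 → π m ∈ (φ p).1 := fun m p hp =>
    hvs m p hp (hπ m)
  -- `φ` injects the sets containing `m` into the sets containing `π m`; the two families are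
  -- equally large, so nothing else can map there.
  have hbwd : ∀ (m : Fin M) (p : Subsets M s), π m ∈ (φ p).1 → m ∈ p.1 := by
    intro m p hp
    have him : (Finset.univ.filter fun p : Subsets M s => m ∈ p.1).image φ =
        Finset.univ.filter fun p : Subsets M s => π m ∈ p.1 := by
      refine Finset.eq_of_subset_of_card_le ?_ ?_
      · intro q hq
        obtain ⟨r, hr, rfl⟩ := Finset.mem_image.1 hq
        simpa using hfwd m r (by simpa using hr)
      · rw [Finset.card_image_of_injective _ hφ, card_subsets_mem m (π m)]
    have : φ p ∈ (Finset.univ.filter fun p : Subsets M s => m ∈ p.1).image φ := by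
      rw [him]; simpa using hp
    obtain ⟨q, hq, hqp⟩ := Finset.mem_image.1 this
    rw [← hφ hqp]
    simpa using hq
  have hπi : Function.Injective π := by
    intro m n hmn
    by_contra hne
    obtain ⟨p, hp, hp'⟩ := exists_subset_mem_notMem hs hsM hne
    exact hp' (hbwd n p (hmn ▸ hfwd m p hp))
  have hπb : Function.Bijective π := Finite.injective_iff_bijective.1 hπi
  refine ⟨Equiv.ofBijective π hπb, fun m => v m (π m), hπ, fun m => ?_⟩
  -- Another index of the support would be `π n` with `n ≠ m`; a set containing `m` but not `n`
  -- rules it out.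
  have hsupp : Function.support (v m) ⊆ (({π m} : Finset (Fin M)) : Set (Fin M)) := by
    intro k hk
    obtain ⟨n, rfl⟩ := hπb.2 k
    by_contra hne
    have hmn : m ≠ n := fun h => hne (by simp [h])
    obtain ⟨p, hp, hp'⟩ := exists_subset_mem_notMem hs hsM hmn
    exact hp' (hbwd n p (hvs m p hp hk))
  rw [← hv m, mulVec_eq_sum_of_support_subset D hsupp]
  simp

/-- The inverse appears because right multiplication by the matrix of a permutation `τ` puts column
`τ⁻¹ m` in position `m`. -/
theorem eq_mul_permScaling_of_col {D D' : Matrix (Fin N) (Fin M) ℝ} {σ : Equiv.Perm (Fin M)}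
    {c : Fin M → ℝ} (h : ∀ m, D'.col m = c m • D.col (σ m)) :
    D' = D * (σ⁻¹.permMatrix ℝ * Matrix.diagonal c) := by
  rw [← Matrix.mul_assoc, Equiv.Perm.permMatrix, PEquiv.mul_toMatrix_toPEquiv]
  ext i m
  have := congrFun (h m) i
  simpa [mul_comm, ← Equiv.Perm.inv_def] using this

theorem hammingNorm_permScaling_le {X : Matrix (Fin M) (Fin L) ℝ} (σ : Equiv.Perm (Fin M))
    (c : Fin M → ℝ) (i : Fin L) :
    hammingNorm ((σ.permMatrix ℝ * Matrix.diagonal c * X).col i) ≤ hammingNorm (X.col i) := by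
  classical
  rw [Matrix.mul_assoc, Equiv.Perm.permMatrix, PEquiv.toMatrix_toPEquiv_mul, hammingNorm,
    hammingNorm]
  refine Finset.card_le_card_of_injOn σ ?_ σ.injective.injOn
  intro m hm
  have hm' : ¬(c (σ m) = 0 ∨ X (σ m) i = 0) := by simpa using hm
  exact Finset.mem_coe.2 (Finset.mem_filter.2 ⟨Finset.mem_univ _, fun h => hm' (Or.inr h)⟩)

theorem Assumptions.isUniqueFactorization {D : Matrix (Fin N) (Fin M) ℝ}
    {X : Matrix (Fin M) (Fin L) ℝ} (hs : 0 < s) (hsM : s < M) (h : Assumptions s D X) :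
    IsUniqueFactorization s (D * X) D X := by
  refine ⟨⟨rfl, fun i => (h.1.1 i).le⟩, fun D' X' h' => ?_⟩
  obtain ⟨φ, hφ, hspan⟩ := h.exists_injective_span_eq hs hsM.le h'
  obtain ⟨σ, c, hc, hcol⟩ := exists_perm_scaling_col hs hsM h.1.2 hφ hspan
  have hZ := eq_mul_permScaling_of_col hcol
  refine ⟨_, ⟨σ⁻¹, c, hc, rfl⟩, hZ, ?_⟩
  have hcols : ∀ i, X.col i = (σ⁻¹.permMatrix ℝ * Matrix.diagonal c * X').col i := by
    intro i
    obtain ⟨S, hS, hS'⟩ := exists_support_subset_card_eq (h.1.1 i).le hsM.le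
    obtain ⟨T, hT, hT'⟩ := exists_support_subset_card_eq
      ((hammingNorm_permScaling_le (X := X') σ⁻¹ c i).trans (h'.2 i)) hsM.le
    refine eq_of_mulVec_eq h.1.2 hS.le hT.le hS' hT' ?_
    rw [← mul_col, ← mul_col, h'.1, ← Matrix.mul_assoc, ← hZ]
  ext m i
  exact congrFun (hcols i) m

/-! ### Codes in general position and sharpness -/

/-- The vectors supported in `S`. -/
def supportedIn (S : Finset (Fin M)) : Submodule ℝ (Fin M → ℝ) where
  carrier := {v | Function.support v ⊆ S}
  zero_mem' := by simp
  add_mem' {v w} hv hw := (Function.support_add v w).trans (Set.union_subset hv hw)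
  smul_mem' c v hv := (Function.support_const_smul_subset c v).trans hv

theorem mem_supportedIn {S : Finset (Fin M)} {v : Fin M → ℝ} :
    v ∈ supportedIn S ↔ Function.support v ⊆ S := Iff.rfl

/-- A data point generated by exactly the atoms in `S` can be chosen outside of finitely many
subspaces that do not contain all of these atoms, and outside of a finite set. -/
theorem exists_code_avoiding {D : Matrix (Fin N) (Fin M) ℝ} (hs : 0 < s)
    (hD : 2 * (s : ℕ∞) < spark D) {S : Finset (Fin M)} (hS : S.card = s)
    (B : Finset (Submodule ℝ (Fin N → ℝ))) (hB : ∀ W ∈ B, ¬ atomSpan D S ≤ W)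
    (E : Finset (Fin N → ℝ)) :
    ∃ v : Fin M → ℝ, Function.support v = S ∧ (∀ W ∈ B, D.mulVec v ∉ W) ∧ D.mulVec v ∉ E := by
  classical
  -- Coordinate hyperplanes, to force full support, and preimages of the `W`: all proper, so over an
  -- infinite field they do not cover.
  let C : Finset (Submodule ℝ (supportedIn S)) :=
    S.image (fun m => (LinearMap.ker (LinearMap.proj (R := ℝ) (φ := fun _ : Fin M => ℝ) m)).comap
      (supportedIn S).subtype) ∪
    B.image (fun W => (W.comap D.mulVecLin).comap (supportedIn S).subtype)
  have hC : ⊤ ∉ C := by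
    intro h
    rcases Finset.mem_union.1 h with h | h
    · obtain ⟨m, hm, h⟩ := Finset.mem_image.1 h
      have hsing : (Pi.single m 1 : Fin M → ℝ) ∈ supportedIn S := by
        rw [mem_supportedIn]
        exact Pi.support_single_subset.trans (by simpa using hm)
      have : (⟨_, hsing⟩ : supportedIn S) ∈ (⊤ : Submodule ℝ (supportedIn S)) := trivial
      rw [← h] at this
      simp at this
    · obtain ⟨W, hW, h⟩ := Finset.mem_image.1 h
      refine hB W hW fun y hy => ?_
      obtain ⟨v, hv, rfl⟩ := exists_mulVec_eq_of_mem_atomSpan hy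
      have : (⟨v, hv⟩ : supportedIn S) ∈ (⊤ : Submodule ℝ (supportedIn S)) := trivial
      rw [← h] at this
      simpa using this
  obtain ⟨v, hv⟩ := (Set.ne_univ_iff_exists_notMem _).1
    (Subspace.biUnion_ne_univ_of_top_notMem hC)
  simp only [Set.mem_iUnion, not_exists] at hv
  have hvS : Function.support v.1 = S := by
    refine Set.Subset.antisymm v.2 fun m hm h0 => ?_
    refine hv _ (Finset.mem_union_left _ (Finset.mem_image_of_mem _ hm)) ?_
    simpa using h0
  have hvB : ∀ W ∈ B, D.mulVec v.1 ∉ W := by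
    intro W hW h0
    refine hv _ (Finset.mem_union_right _ (Finset.mem_image_of_mem _ hW)) ?_
    simpa using h0
  have hv0 : D.mulVec v.1 ≠ 0 := by
    intro h0
    have : v.1 = 0 := eq_of_mulVec_eq hD hS.le hS.le v.2 (by simp) (by simpa using h0)
    rw [this, Function.support_zero] at hvS
    have hSe : S = ∅ := by exact_mod_cast hvS.symm
    rw [hSe, Finset.card_empty] at hS
    omega
  -- Nonzero rescaling preserves the support and the avoidance of subspaces, and the line is
  -- infinite, so it leaves `E`.
  have hinf : ((fun t : ℝ => t • D.mulVec v.1) '' {0}ᶜ).Infinite :=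
    (Set.finite_singleton (0 : ℝ)).infinite_compl.image (smul_left_injective ℝ hv0).injOn
  obtain ⟨_, ⟨t, ht, rfl⟩, htE⟩ := hinf.exists_notMem_finset E
  have ht0 : t ≠ 0 := by simpa using ht
  refine ⟨t • v.1, ?_, fun W hW h => hvB W hW ?_, by rwa [Matrix.mulVec_smul]⟩
  · rw [Function.support_const_smul_of_ne_zero t v.1 ht0, hvS]
  · rw [Matrix.mulVec_smul] at h
    exact (W.smul_mem_iff ht0).1 h

/-- Data points with prescribed sets of atoms in general position. -/
theorem exists_codes_general_position {ι : Type*} {D : Matrix (Fin N) (Fin M) ℝ} (hs : 0 < s)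
    (hD : 2 * (s : ℕ∞) < spark D) (f : ι → Subsets M s) (A : Finset ι) :
    ∃ x : ι → Fin M → ℝ, (∀ i ∈ A, Function.support (x i) = ((f i).1 : Set (Fin M))) ∧
      Set.InjOn (fun i => D.mulVec (x i)) (A : Set ι) ∧
      ∀ I ⊆ A, I.card ≤ s + 1 → (I.card = s + 1 → ¬ ∀ i ∈ I, ∀ k ∈ I, f i = f k) →
        LinearIndepOn ℝ (fun i => D.mulVec (x i)) (I : Set ι) := by
  classical
  induction A using Finset.induction_on with
  | empty =>
    refine ⟨0, by simp, by simp, fun I hI _ _ => ?_⟩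
    rw [Finset.subset_empty.1 hI, Finset.coe_empty]
    exact linearIndepOn_empty ℝ _
  | insert a A ha ih =>
    obtain ⟨x, hx, hinj, hind⟩ := ih
    let y : ι → Fin N → ℝ := fun i => D.mulVec (x i)
    obtain ⟨v, hvS, hvB, hvE⟩ := exists_code_avoiding hs hD (f a).2
      ((A.powerset.image fun Q : Finset ι => Submodule.span ℝ (y '' (Q : Set ι))).filter
        fun W => ¬ atomSpan D (f a).1 ≤ W) (fun W hW => (Finset.mem_filter.1 hW).2) (A.image y)
    let x' := Function.update x a v
    have hxa : x' a = v := Function.update_self ..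
    have hxA : ∀ i ∈ A, x' i = x i := fun i hi =>
      Function.update_of_ne (fun h : i = a => ha (h ▸ hi)) ..
    refine ⟨x', ?_, ?_, ?_⟩
    · intro i hi
      rcases Finset.mem_insert.1 hi with rfl | hi
      · rw [hxa, hvS]
      · rw [hxA i hi, hx i hi]
    · rw [Finset.coe_insert, Set.injOn_insert (by simpa using ha)]
      refine ⟨fun i hi k hk h => ?_, ?_⟩
      · simp only [hxA i hi, hxA k hk] at h
        exact hinj hi hk h
      · rintro ⟨i, hi, h⟩
        simp only [hxA i hi, hxa] at h
        exact hvE (Finset.mem_image.2 ⟨i, hi, h⟩)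
    · have hold : ∀ Q ⊆ A, Q.card ≤ s + 1 → (Q.card = s + 1 → ¬ ∀ i ∈ Q, ∀ k ∈ Q, f i = f k) →
          LinearIndepOn ℝ (fun i => D.mulVec (x' i)) (Q : Set ι) := by
        intro Q hQ hc hns
        exact (hind Q hQ hc hns).congr fun i hi => by simp only [hxA i (hQ hi)]
      intro I hI hc hns
      by_cases haI : a ∈ I
      swap
      · exact hold I (fun i hi => (Finset.mem_insert.1 (hI hi)).resolve_left
          fun h => haI (h ▸ hi)) hc hns
      have hQA : I.erase a ⊆ A := Finset.subset_insert_iff.1 hI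
      set Q := I.erase a with hQ
      have hIQ : I = insert a Q := (Finset.insert_erase haI).symm
      have haQ : a ∉ Q := Finset.notMem_erase a I
      have hcQ : Q.card + 1 = I.card := Finset.card_erase_add_one haI
      have hQi := hind Q hQA (by omega) (fun h => by omega)
      rw [hIQ, Finset.coe_insert, linearIndepOn_insert (by simpa using haQ)]
      refine ⟨hold Q hQA (by omega) (fun h => by omega), fun hmem => ?_⟩
      have himg : (fun i => D.mulVec (x' i)) '' (Q : Set ι) = y '' (Q : Set ι) :=
        Set.image_congr fun i hi => by simp only [y, hxA i (hQA hi)]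
      rw [himg] at hmem
      simp only [hxa] at hmem
      -- Only spans containing all of `atomSpan D (f a).1` were not avoided. As `Q` has at most `s`
      -- points, such a span equals it, and uniqueness of codes gives every point of `Q` the support
      -- of `a`.
      by_cases hle : atomSpan D (f a).1 ≤ Submodule.span ℝ (y '' (Q : Set ι))
      swap
      · exact hvB _ (Finset.mem_filter.2 ⟨Finset.mem_image.2
          ⟨Q, Finset.mem_powerset.2 hQA, rfl⟩, hle⟩) hmem
      have hrQ : finrank ℝ (Submodule.span ℝ (y '' (Q : Set ι))) = Q.card :=
        finrank_span_image_of_linearIndepOn hQi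
      have hrS := finrank_atomSpan hD (f a).2
      have hge := Submodule.finrank_mono hle
      have heq := Submodule.eq_of_le_of_finrank_le hle (by omega)
      have hfQ : ∀ i ∈ Q, f i = f a := by
        intro i hi
        have hyi : y i ∈ atomSpan D (f a).1 := by
          rw [heq]
          exact Submodule.subset_span ⟨i, hi, rfl⟩
        obtain ⟨w, hw, hw'⟩ := exists_mulVec_eq_of_mem_atomSpan hyi
        have hxi := hx i (hQA hi)
        have hwx : w = x i := eq_of_mulVec_eq hD (f a).2.le (f i).2.le hw hxi.subset hw'
        rw [hwx, hxi] at hw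
        refine Subtype.ext (Finset.eq_of_subset_of_card_le (by exact_mod_cast hw) ?_)
        rw [(f i).2, (f a).2]
      have hfI : ∀ i ∈ I, f i = f a := by
        intro i hi
        rw [hIQ] at hi
        rcases Finset.mem_insert.1 hi with rfl | hi
        · rfl
        · exact hfQ i hi
      exact hns (by omega) fun i hi k hk => (hfI i hi).trans (hfI k hk).symm

/-- If every set of `s` atoms is prescribed at least `s + 1` times, then the assumptions hold for
suitable codes with the prescribed supports. -/
theorem exists_assumptions {D : Matrix (Fin N) (Fin M) ℝ} (hs : 0 < s)
    (hD : 2 * (s : ℕ∞) < spark D) (f : Fin L → Subsets M s)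
    (hf : ∀ S, s + 1 ≤ (Finset.univ.filter (f · = S)).card) :
    ∃ X : Matrix (Fin M) (Fin L) ℝ,
      (∀ i, Function.support (X.col i) = ((f i).1 : Set (Fin M))) ∧ Assumptions s D X := by
  classical
  obtain ⟨x, hx, hinj, hind⟩ := exists_codes_general_position hs hD f Finset.univ
  have hsupp : ∀ i, Function.support ((Matrix.of x).transpose.col i) =
      ((f i).1 : Set (Fin M)) := fun i => hx i (Finset.mem_univ i)
  have hY : (D * (Matrix.of x).transpose).col = fun i => D.mulVec (x i) := rfl
  have hinj' : Function.Injective (D * (Matrix.of x).transpose).col := by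
    rw [hY]
    simpa [Set.injOn_univ] using hinj
  refine ⟨(Matrix.of x).transpose, hsupp, ⟨fun i => ?_, hD⟩, fun S hS => ?_, fun I hI _ => ?_⟩
  · rw [hammingNorm_eq_card_of_support_eq (hsupp i), (f i).2]
  · rw [Set.ncard_image_of_injective _ hinj']
    have : {i | Function.support ((Matrix.of x).transpose.col i) = (S : Set (Fin M))} =
        (Finset.univ.filter (f · = ⟨S, hS⟩) : Finset (Fin L)) := by
      ext i
      simp only [Set.mem_ofPred_eq, hsupp, Finset.coe_filter, Finset.mem_univ, true_and,
        Subtype.ext_iff, Finset.coe_inj]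
    rw [this, Set.ncard_coe_finset]
    exact hf ⟨S, hS⟩
  · have hsame : SameAtoms (Matrix.of x).transpose I ↔ ∀ i ∈ I, ∀ k ∈ I, f i = f k := by
      simp only [SameAtoms, hsupp, Finset.coe_inj, Subtype.ext_iff]
    rw [hsame, hY, Set.finrank]
    refine ⟨fun h => ?_, fun h => ?_⟩
    · obtain ⟨i₀, hi₀⟩ := Finset.card_pos.1 (by omega : 0 < I.card)
      refine le_antisymm ?_ ?_
      · rw [← finrank_atomSpan hD (f i₀).2]
        refine Submodule.finrank_mono (Submodule.span_le.2 ?_)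
        rintro _ ⟨i, hi, rfl⟩
        rw [h i₀ hi₀ i hi]
        exact mulVec_mem_atomSpan D (hsupp i).subset
      -- Any `s` of the points are independent, whatever their supports.
      · have hc : (I.erase i₀).card = s := by rw [Finset.card_erase_of_mem hi₀, hI]; rfl
        rw [← hc, ← finrank_span_image_of_linearIndepOn (hind (I.erase i₀)
          (Finset.subset_univ _) (by omega) (fun h => by omega))]
        exact Submodule.finrank_mono (Submodule.span_mono
          (Set.image_mono (by simp)))
    · rw [finrank_span_image_of_linearIndepOn (hind I (Finset.subset_univ _) hI.le fun _ => h), hI]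

theorem exists_profile (M s : ℕ) :
    ∃ f : Fin ((s + 1) * M.choose s) → Subsets M s,
      ∀ S, s + 1 ≤ (Finset.univ.filter (f · = S)).card := by
  classical
  have hcard : Fintype.card (Fin ((s + 1) * M.choose s)) =
      Fintype.card (Fin (s + 1) × Subsets M s) := by
    rw [Fintype.card_prod, Fintype.card_finset_len]
    simp
  let e := Fintype.equivOfCardEq hcard
  refine ⟨fun i => (e i).2, fun S => ?_⟩
  have hle := Finset.card_le_card_of_injOn (s := (Finset.univ : Finset (Fin (s + 1))))
    (t := Finset.univ.filter fun i => (e i).2 = S) (fun k => e.symm (k, S)) (by intro k _; simp)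
    (fun k _ l _ h => by simpa using h)
  simpa using hle

end DictLearning

theorem mainTheorem10 (J M s : ℕ) (N : Fin J → ℕ) (hs : 0 < s) (hsM : s < M)
    (D : (j : Fin J) → Matrix (Fin (N j)) (Fin M) ℝ) :
    (∀ (L : ℕ) (X : Fin J → Matrix (Fin M) (Fin L) ℝ)
        (Y : (j : Fin J) → Matrix (Fin (N j)) (Fin L) ℝ),
      (∀ j, Y j = D j * X j) → (∀ j, DictLearning.Assumptions s (D j) (X j)) →
        (∀ j, DictLearning.IsUniqueFactorization s (Y j) (D j) (X j)) ∧
          J * ((s + 1) * M.choose s) ≤ J * L) ∧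
    ((∀ j, 2 * (s : ℕ∞) < DictLearning.spark (D j)) →
      IsLeast {n : ℕ | ∃ (L : ℕ) (X : Fin J → Matrix (Fin M) (Fin L) ℝ),
          n = J * L ∧ DictLearning.CommonSparsityProfile X ∧
            ∀ j, DictLearning.Assumptions s (D j) (X j)}
        (J * ((s + 1) * M.choose s))) := by
  have hlower : ∀ (L : ℕ) (X : Fin J → Matrix (Fin M) (Fin L) ℝ),
      (∀ j, DictLearning.Assumptions s (D j) (X j)) →
        J * ((s + 1) * M.choose s) ≤ J * L := by
    intro L X h
    -- With no modality nothing constrains `L`, but both sides vanish.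
    rcases Nat.eq_zero_or_pos J with rfl | hJ
    · simp
    · exact Nat.mul_le_mul_left J (h ⟨0, hJ⟩).2.1.le_card
  refine ⟨fun L X Y hY h => ⟨fun j => ?_, hlower L X h⟩, fun hD => ⟨?_, ?_⟩⟩
  · rw [hY j]
    exact (h j).isUniqueFactorization hs hsM
  -- One profile `f` serves all modalities, which makes the supports agree.
  · obtain ⟨f, hf⟩ := DictLearning.exists_profile M s
    choose X hX hA using fun j => DictLearning.exists_assumptions hs (hD j) f hf
    exact ⟨_, X, rfl, fun i j j' => (hX j i).trans (hX j' i).symm, hA⟩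
  · rintro n ⟨L, X, rfl, -, h⟩
    exact hlower L X h
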